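/- Consider a switched server system with three tanks and parameters $d_{ij}>0$ ($1\le i,j\le 3$, $i\ne j$): each tank is filled at the constant rate $\frac13$, a server removes fluid at rate $1$ from the tank at which it is located, and when the server empties tank $i$ while the volumes are $v=(v_1,v_2,v_3)$, it moves to the tank $j\neq i$ with the largest scaled volume $d_{ij}v_j$ (ties being broken by any fixed rule depending on $i$ and $v$). The server position is right-continuous in time, and the state $v(t)$ lives in $\Delta=\{v: v_1,v_2,v_3\ge 0,\ v_1+v_2+v_3=1\}$. The Poincaré map $F:\partial\Delta\to\partial\Delta$ sends a boundary state, at which the server has just emptied a tank, to the next state at which the trajectory is in $\partial\Delta$. The global attractor of $F$ is $\omega(F)=\bigcup_{v\in\partial\Delta}\bigcap_{r\ge 0}\overline{\{F^k(v):k\ge r\}}$. Let $x_1\in(0,\frac13)$, $x_2\in(\frac13,\frac23)$ and $x_3\in(\frac23,1)$ each be either rational, or irrational with a $4$-ary expansion that contains all words of length $3$ over $\{0,1,2,3\}$, and let $$d_1=\frac{1}{3x_1}-1,\qquad d_2=\frac{2-3x_2}{3x_2-1},\qquad d_3=\frac{3-3x_3}{3x_3-2}.$$ Then for every switched server system whose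 parameters satisfy $$\frac{d_{13}}{d_{12}}=d_1,\qquad \frac{d_{21}}{d_{23}}=d_2,\qquad \frac{d_{32}}{d_{31}}=d_3,$$ the Poincaré map $F:\partial\Delta\to\partial\Delta$ is well defined and its global attractor $\omega(F)$ is finite. -/

import Mathlib

open Set Filter Topology

/-- The 4-ary expansion of `x`, some infinite word `w` over `{0,1,2,3}` with
`x = ∑ i, w i * 4 ^ (-(i+1))`, contains all words of length `k` over `{0,1,2,3}`. -/
def ContainsAllWordsBaseFour (k : ℕ) (x : ℝ) : Prop :=
  ∃ w : ℕ → Fin 4, x = Real.ofDigits w ∧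
    ∀ u : Fin k → Fin 4, ∃ m : ℕ, ∀ j : Fin k, w (m + j) = u j

/-- The boundary `∂Δ` of the phase space
`Δ = {v : v₁, v₂, v₃ ≥ 0, v₁ + v₂ + v₃ = 1}`: at least one tank is empty. -/
def simplexBoundary : Set (Fin 3 → ℝ) :=
  {v | v ∈ stdSimplex ℝ (Fin 3) ∧ ∃ i, v i = 0}

/-- A switched server system with three buffers (indexed by `0, 1, 2`), given by its positive
parameters `d i j` (`i ≠ j`; the diagonal plays no role) and a rule `next`: when the server has
emptied tank `i` and the state is `v`, it moves to the tank `next i v ≠ i`, which has the largest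
scaled volume `d i j * v j` among the tanks `j ≠ i`. The rule is determined by `d` except that
ties may be broken in any way depending on the state. -/
structure SwitchedServerSystem where
  d : Fin 3 → Fin 3 → ℝ
  d_pos : ∀ i j, i ≠ j → 0 < d i j
  next : Fin 3 → (Fin 3 → ℝ) → Fin 3
  next_ne : ∀ i, ∀ v ∈ stdSimplex ℝ (Fin 3), v i = 0 → next i v ≠ i
  next_max : ∀ i, ∀ v ∈ stdSimplex ℝ (Fin 3), v i = 0 →
    ∀ j, j ≠ i → d i j * v j ≤ d i (next i v) * v (next i v)

namespace SwitchedServerSystem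

/-- Volumes `v` and server position `l` evolve during the time interval `[0, T]` according to the
system: every tank is filled at rate `1/3`, and the tank where the server is located is drained
at rate `1`. -/
structure IsTrajectory (S : SwitchedServerSystem) (T : ℝ)
    (v : ℝ → Fin 3 → ℝ) (l : ℝ → Fin 3) : Prop where
  mem_simplex : ∀ t ∈ Icc 0 T, v t ∈ stdSimplex ℝ (Fin 3)
  continuousOn : ContinuousOn v (Icc 0 T)
  /-- the server position is right-continuous -/
  right_continuous : ∀ t ∈ Ico 0 T, ContinuousWithinAt l (Ici t) t
  /-- balance of inflow and outflow (right derivatives) -/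
  hasDeriv : ∀ t ∈ Ico 0 T,
    HasDerivWithinAt v (fun i => 1 / 3 - if l t = i then 1 else 0) (Ici t) t
  /-- if the server is at tank `i` immediately before time `t`, then it stays there as long as
  tank `i` is not empty, and moves to the next tank when tank `i` is emptied -/
  switching : ∀ t ∈ Ioc 0 T, ∃ i, (∀ᶠ s in 𝓝[<] t, l s = i) ∧
    (0 < v t i → l t = i) ∧ (v t i = 0 → l t = S.next i (v t))

/-- The trajectory starting at the boundary state `p`, at a moment when the server has just
emptied a tank, returns to the boundary for the first time at the state `q`. -/
def FirstReturn (S : SwitchedServerSystem) (p q : Fin 3 → ℝ) : Prop :=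
  ∃ (T : ℝ) (v : ℝ → Fin 3 → ℝ) (l : ℝ → Fin 3), 0 < T ∧ S.IsTrajectory T v l ∧
    v 0 = p ∧ (∃ i, p i = 0 ∧ l 0 = S.next i p) ∧
    (∀ t ∈ Ioo 0 T, v t ∉ simplexBoundary) ∧ v T ∈ simplexBoundary ∧ v T = q

/-- `F` is the Poincaré map of the system on the boundary of the phase space: its graph is the
first-return relation (so `F` is unique if it exists). -/
def IsPoincareMap (S : SwitchedServerSystem) (F : simplexBoundary → simplexBoundary) : Prop :=
  ∀ p q : simplexBoundary, F p = q ↔ S.FirstReturn p q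

end SwitchedServerSystem

/-- The global attractor `ω(F)`: the union over all points `x` of the `ω`-limit sets
`⋂ r, closure {F^k x : k ≥ r}`. -/
def globalAttractor {X : Type*} [TopologicalSpace X] (F : X → X) : Set X :=
  ⋃ x : X, omegaLimit atTop (fun (n : ℕ) (y : X) => F^[n] y) {x}

/-! Parametrize `∂Δ` as a circle of length 1. Draining one tank then reads `x ↦ (c x - x) / 2` with
`c x ∈ {1, 2}`. The branch `c` jumps only at `x₁`, `x₂`, `x₃`, where two scaled volumes tie; at a
vertex only one tank is nonempty, so there is no choice. Forwards each branch halves distances;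
backwards the map is `x ↦ -2 x` modulo 1, whichever branch was used.

An orbit that eventually keeps a distance from the jumps has two close terms by pigeonhole. No jump
ever separates them, so they contract together (`isAsymptoticallyPeriodic_of_avoids`). An orbit
passing near a rational jump has shadowed, backwards in time, the orbit of that jump under `-2`,
which is finite modulo 1. Pigeonhole gives a closed loop, which is then followed forever with
shrinking error (`isTameAt_ratCast`). A jump whose expansion contains all words of length 3 is not
approached at late times: the image of the map omits an interval of length `1/8`, some `4 ^ m * d`
lies well inside it modulo 1, and an orbit near `d` would have been there `2 * m` steps earlier
(`isTameAt_of_containsAllWords`).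

All periods share a bound `N`, so every cluster point `y` satisfies `((-2) ^ p - 1) * y ∈ ℤ` for
some positive `p ≤ N`; this leaves finitely many `y`. -/

/-! ### Orbits of piecewise halving maps -/

/-- Forward orbits in `(0, 1)` of the piecewise contraction `x ↦ (c x - x) / 2`. -/
def IsHalvingOrbit (c : ℝ → ℤ) (u : ℕ → ℝ) : Prop :=
  ∀ n, u n ∈ Ioo (0 : ℝ) 1 ∧ u (n + 1) = (c (u n) - u n) / 2

/-- The branch `c` is constant on the intervals in `(0, 1)` that do not meet `D`. -/
def IsBranch (D : Finset ℝ) (c : ℝ → ℤ) : Prop :=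
  ∀ x ∈ Ioo (0 : ℝ) 1, ∀ y ∈ Ioo (0 : ℝ) 1, x ≤ y → (∀ d ∈ D, d < x ∨ y < d) → c x = c y

/-- The sequence `u` approaches its shift by some positive `p ≤ N`. -/
def IsAsymptoticallyPeriodic (N : ℕ) (u : ℕ → ℝ) : Prop :=
  ∃ p, 0 < p ∧ p ≤ N ∧ Tendsto (fun k => u (k + p) - u k) atTop (𝓝 0)

lemma IsAsymptoticallyPeriodic.mono {M N : ℕ} (h : M ≤ N) {u : ℕ → ℝ}
    (hu : IsAsymptoticallyPeriodic M u) : IsAsymptoticallyPeriodic N u := by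
  obtain ⟨p, hp, hpM, ht⟩ := hu
  exact ⟨p, hp, hpM.trans h, ht⟩

lemma tendsto_zero_of_abs_shift_le {v : ℕ → ℝ} {m : ℕ} {C : ℝ}
    (h : ∀ k, |v (m + k)| ≤ C * (1 / 2) ^ k) : Tendsto v atTop (𝓝 0) := by
  rw [← tendsto_add_atTop_iff_nat m]
  refine squeeze_zero_norm (a := fun k => C * (1 / 2 : ℝ) ^ k) (fun k => ?_) ?_
  · rw [Real.norm_eq_abs, add_comm]; exact h k
  · simpa using (tendsto_pow_atTop_nhds_zero_of_lt_one (r := (1 / 2 : ℝ)) (by norm_num)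
      (by norm_num)).const_mul C

namespace IsHalvingOrbit

variable {D : Finset ℝ} {c : ℝ → ℤ} {u : ℕ → ℝ}

/-- Both branches invert to multiplication by `-2` up to an integer, so the past modulo 1 does not
depend on the branches taken. -/
lemma backward_int (hu : IsHalvingOrbit c u) (k p : ℕ) :
    ∃ z : ℤ, (-2 : ℝ) ^ p * u (k + p) - u k = z := by
  induction p with
  | zero => exact ⟨0, by simp⟩
  | succ p ih =>
    obtain ⟨z, hz⟩ := ih
    refine ⟨z - (-2) ^ p * c (u (k + p)), ?_⟩
    have h := (hu (k + p)).2
    rw [← add_assoc, h, pow_succ]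
    push_cast
    linear_combination hz

/-- The two points lie on the same side of `r`. A jump between them would differ from `r` and be
closer to it than `ρ`; a jump at `r` itself does no harm. -/
lemma branch_eq (hc : IsBranch D c) (hu : IsHalvingOrbit c u) {r a t ρ : ℝ} {i j : ℕ}
    (hr : ∀ d ∈ D, r ≠ d → ρ ≤ |r - d|) (ha : |a| < ρ) (ht : 0 < t) (ht1 : t ≤ 1)
    (hi : u i = r + a) (hj : u j = r + a * t) : c (u i) = c (u j) := by
  rcases lt_trichotomy a 0 with h | h | h
  · refine hc _ (hu i).1 _ (hu j).1 (by nlinarith) fun d hd => ?_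
    by_contra! hcon
    have h1 : d < r := by nlinarith [hcon.2, mul_neg_of_neg_of_pos h ht]
    have h2 := hr d hd h1.ne'
    rw [abs_of_pos (by linarith)] at h2
    rw [abs_of_neg h] at ha
    linarith [hcon.1]
  · rw [hi, hj, h]; simp
  · refine (hc _ (hu j).1 _ (hu i).1 (by nlinarith) fun d hd => ?_).symm
    by_contra! hcon
    have h1 : r < d := by nlinarith [hcon.1, mul_pos h ht]
    have h2 := hr d hd h1.ne
    rw [abs_of_neg (by linarith)] at h2
    rw [abs_of_pos h] at ha
    linarith [hcon.2]

/-- An orbit segment of even length that is close to a finite set and whose error term closes up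
is repeated forever. -/
lemma tendsto_of_segment (hc : IsBranch D c) (hu : IsHalvingOrbit c u) {R : Set ℝ} {ρ η : ℝ}
    (hR : ∀ r ∈ R, ∀ d ∈ D, r ≠ d → ρ ≤ |r - d|) (hη : |η| < ρ) {m p : ℕ} (hp : Even p) (hp0 : 0 < p)
    (hmem : ∀ k ≤ p, u (m + k) - (-1 / 2) ^ k * η ∈ R)
    (hper : u (m + p) - (-1 / 2) ^ p * η = u m - η) :
    Tendsto (fun k => u (k + p) - u k) atTop (𝓝 0) := by
  have hpp : (-1 / 2 : ℝ) ^ p = (1 / 2) ^ p := by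
    rw [show (-1 / 2 : ℝ) = -(1 / 2) by norm_num, hp.neg_pow]
  have key : ∀ k, (∀ i ≤ k + p, u (m + i) - (-1 / 2) ^ i * η ∈ R) ∧
      u (m + (k + p)) - (-1 / 2) ^ (k + p) * η = u (m + k) - (-1 / 2) ^ k * η := by
    intro k
    induction k with
    | zero => exact ⟨by simpa using hmem, by simpa using hper⟩
    | succ k ih =>
      obtain ⟨ih1, ih2⟩ := ih
      have hak : |(-1 / 2 : ℝ) ^ k * η| < ρ := by
        refine lt_of_le_of_lt ?_ hη
        rw [abs_mul, abs_pow]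
        exact mul_le_of_le_one_left (abs_nonneg _) (pow_le_one₀ (abs_nonneg _) (by norm_num))
      -- As `p` is even, the errors one period apart have the same sign, so both points leave the
      -- reference point on the same side.
      have hb : c (u (m + k)) = c (u (m + (k + p))) := by
        refine branch_eq hc hu (r := u (m + k) - (-1 / 2) ^ k * η) (a := (-1 / 2) ^ k * η)
          (t := (1 / 2) ^ p) (hR _ (ih1 k (by omega))) hak (by positivity)
          (pow_le_one₀ (by norm_num) (by norm_num)) (by ring) ?_
        rw [← hpp, ← ih2, pow_add]; ring
      have h1 := (hu (m + k)).2
      have h2 := (hu (m + (k + p))).2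
      rw [hb] at h1
      have hnew : u (m + (k + 1 + p)) - (-1 / 2) ^ (k + 1 + p) * η =
          u (m + (k + 1)) - (-1 / 2) ^ (k + 1) * η := by
        rw [show m + (k + 1 + p) = m + (k + p) + 1 by ring, ← add_assoc m k 1, h1, h2,
          show k + 1 + p = k + p + 1 by ring, pow_succ _ (k + p), pow_succ _ k]
        linear_combination (-1 / 2 : ℝ) * ih2
      refine ⟨fun i hi => ?_, hnew⟩
      rcases Nat.lt_or_ge i (k + 1 + p) with h | h
      · exact ih1 i (by omega)
      · obtain rfl : i = k + 1 + p := le_antisymm hi h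
        rw [hnew]
        exact ih1 (k + 1) (by omega)
  refine tendsto_zero_of_abs_shift_le (m := m) (C := 2 * |η|) fun k => ?_
  have h := (key k).2
  have e : u (m + k + p) - u (m + k) = ((-1 / 2) ^ p - 1) * ((-1 / 2) ^ k * η) := by
    rw [add_assoc]; rw [pow_add] at h; linear_combination h
  have h1 : |(-1 / 2 : ℝ) ^ p - 1| ≤ 2 := by
    rw [hpp]
    have := pow_le_one₀ (n := p) (show (0 : ℝ) ≤ 1 / 2 by norm_num) (by norm_num)
    have := pow_pos (show (0 : ℝ) < 1 / 2 by norm_num) p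
    rw [abs_le]; constructor <;> linarith
  rw [e, abs_mul, abs_mul, abs_pow, show |(-1 / 2 : ℝ)| = 1 / 2 by
    rw [abs_of_neg] <;> norm_num]
  have := mul_le_mul_of_nonneg_right h1 (show 0 ≤ (1 / 2 : ℝ) ^ k * |η| by positivity)
  linarith

lemma isAsymptoticallyPeriodic_of_avoids (hc : IsBranch D c) (hu : IsHalvingOrbit c u)
    {K M : ℕ} {ε : ℝ} (hε : 0 < ε) (hK : 1 / ε ≤ K) (hav : ∀ n ≥ M, ∀ d ∈ D, ε ≤ |u n - d|) :
    IsAsymptoticallyPeriodic K u := by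
  -- `K` boxes of width `ε` cover `(0, 1)`; `K + 1` terms put two in one box.
  have hmaps : ∀ i ∈ Finset.range (K + 1), ⌊u (M + i) / ε⌋₊ ∈ Finset.range K := by
    intro i _
    have h := (hu (M + i)).1
    rw [Finset.mem_range, Nat.floor_lt (div_nonneg h.1.le hε.le)]
    exact lt_of_lt_of_le (by gcongr; exact h.2) hK
  obtain ⟨i, hi, j, hj, hij, he⟩ :=
    Finset.exists_ne_map_eq_of_card_lt_of_maps_to (by simp) hmaps
  wlog hlt : i < j generalizing i j
  · exact this j hj i hi hij.symm he.symm (by omega)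
  rw [Finset.mem_range] at hj
  have hclose : |u (M + j) - u (M + i)| < ε := by
    have h1 := Nat.floor_le (div_nonneg (hu (M + i)).1.1.le hε.le)
    have h2 := Nat.lt_floor_add_one (u (M + i) / ε)
    have h3 := Nat.floor_le (div_nonneg (hu (M + j)).1.1.le hε.le)
    have h4 := Nat.lt_floor_add_one (u (M + j) / ε)
    rw [he] at h1 h2
    rw [le_div_iff₀ hε] at h1 h3
    rw [div_lt_iff₀ hε] at h2 h4
    rw [abs_lt]; constructor <;> linarith
  refine ⟨j - i, by omega, by omega, ?_⟩
  have key : ∀ k, |u (M + i + k + (j - i)) - u (M + i + k)| ≤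
      |u (M + j) - u (M + i)| * (1 / 2) ^ k := by
    intro k
    induction k with
    | zero => simp [show M + i + (j - i) = M + j by omega]
    | succ k ih =>
      have hlt : |u (M + i + k + (j - i)) - u (M + i + k)| < ε := by
        refine ih.trans_lt (lt_of_le_of_lt ?_ hclose)
        exact mul_le_of_le_one_right (abs_nonneg _) (pow_le_one₀ (by norm_num) (by norm_num))
      have hb : c (u (M + i + k + (j - i))) = c (u (M + i + k)) := by
        rw [abs_lt] at hlt
        rcases le_total (u (M + i + k + (j - i))) (u (M + i + k)) with h | h
        · refine hc _ (hu _).1 _ (hu _).1 h fun d hd => ?_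
          by_contra! hcon
          have := hav (M + i + k) (by omega) d hd
          rw [abs_of_nonneg (by linarith)] at this
          linarith
        · refine (hc _ (hu _).1 _ (hu _).1 h fun d hd => ?_).symm
          by_contra! hcon
          have := hav (M + i + k) (by omega) d hd
          rw [abs_of_nonpos (by linarith)] at this
          linarith
      have e : u (M + i + (k + 1) + (j - i)) - u (M + i + (k + 1)) =
          (-1 / 2) * (u (M + i + k + (j - i)) - u (M + i + k)) := by
        rw [show M + i + (k + 1) + (j - i) = M + i + k + (j - i) + 1 by omega, (hu _).2,
          show M + i + (k + 1) = M + i + k + 1 by omega, (hu (M + i + k)).2, hb]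
        ring
      rw [e, abs_mul, pow_succ, show |(-1 / 2 : ℝ)| = 1 / 2 by rw [abs_of_neg] <;> norm_num]
      linarith
  exact tendsto_zero_of_abs_shift_le key

end IsHalvingOrbit

/-! ### Rational discontinuities -/

/-- Fractions with denominator `Q` in `[-1, 2]`. -/
def boundedFractions (Q : ℕ) : Set ℝ := {r | (∃ z : ℤ, Q * r = z) ∧ r ∈ Icc (-1 : ℝ) 2}

lemma finite_boundedFractions {Q : ℕ} (hQ : 0 < Q) : (boundedFractions Q).Finite := by
  refine ((Set.finite_Icc (-Q : ℤ) (2 * Q)).image fun z : ℤ => (z : ℝ) / Q).subset ?_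
  rintro r ⟨⟨z, hz⟩, h1, h2⟩
  have hQ' : (0 : ℝ) < Q := by exact_mod_cast hQ
  refine ⟨z, ⟨?_, ?_⟩, ?_⟩
  · have : (-Q : ℝ) ≤ z := by rw [← hz]; nlinarith
    exact_mod_cast this
  · have : (z : ℝ) ≤ 2 * Q := by rw [← hz]; nlinarith
    exact_mod_cast this
  · simp only [← hz]; field_simp

/-- Orbits that come close to the discontinuity `d` are asymptotically periodic, uniformly. -/
def IsTameAt (c : ℝ → ℤ) (d : ℝ) : Prop :=
  ∀ᶠ N : ℕ in atTop, ∀ u, IsHalvingOrbit c u → ∀ n ≥ N, |u n - d| < 1 / ((N : ℝ) + 1) →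
    IsAsymptoticallyPeriodic N u

lemma isTameAt_ratCast {D : Finset ℝ} {c : ℝ → ℤ} (hc : IsBranch D c) (q : ℚ) : IsTameAt c q := by
  have hR := finite_boundedFractions q.den_pos
  set R := boundedFractions q.den
  -- The even times `0, 2, …, J` outnumber the elements of `R` by one.
  set J := 2 * hR.toFinset.card with hJ
  obtain ⟨ρ, hρ, hsep⟩ : ∃ ρ > 0, ∀ r ∈ R, ∀ d ∈ D, r ≠ d → ρ ≤ |r - d| := by
    have : ∀ᶠ ρ : ℝ in 𝓝[>] 0, ∀ r ∈ hR.toFinset, ∀ d ∈ D, r ≠ d → ρ ≤ |r - d| := by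
      rw [eventually_all_finset]
      intro r _
      rw [eventually_all_finset]
      intro d _
      by_cases h : r = d
      · simp [h]
      · have := Ioo_mem_nhdsGT (abs_pos.mpr (sub_ne_zero.mpr h))
        filter_upwards [this] with ρ hρ _ using hρ.2.le
    obtain ⟨ρ, h1, h2⟩ := (this.and self_mem_nhdsWithin).exists
    exact ⟨ρ, h2, fun r hr => h1 r (by simpa using hr)⟩
  have hlim : ∀ᶠ N : ℕ in atTop, 2 ^ J * (1 / ((N : ℝ) + 1)) < min ρ 1 := by
    have := (tendsto_one_div_add_atTop_nhds_zero_nat (𝕜 := ℝ)).const_mul (2 ^ J)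
    rw [mul_zero] at this
    exact this.eventually_lt_const (by positivity)
  filter_upwards [hlim, eventually_ge_atTop J] with N hN hJN u hu n hn hclose
  set δ := u n - q with hδ
  have hbig : ∀ j ≤ J, |(-2 : ℝ) ^ j * δ| < min ρ 1 := by
    intro j hj
    refine lt_of_le_of_lt ?_ hN
    rw [abs_mul, abs_pow, show |(-2 : ℝ)| = 2 by simp]
    exact mul_le_mul (pow_le_pow_right₀ (by norm_num) hj) hclose.le (abs_nonneg _) (by positivity)
  -- Subtracting the expanded error leaves `(-2) ^ j * q` up to an integer: the denominator is kept,
  -- and the error is below 1, hence the range `[-1, 2]`.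
  have hg : ∀ j ≤ J, u (n - j) - (-2) ^ j * δ ∈ R := by
    intro j hj
    have hb := abs_lt.mp ((hbig j hj).trans_le (min_le_right _ _))
    have hI := (hu (n - j)).1
    refine ⟨?_, ⟨by linarith [hI.1], by linarith [hI.2]⟩⟩
    obtain ⟨z, hz⟩ := hu.backward_int (n - j) j
    rw [Nat.sub_add_cancel (by omega)] at hz
    refine ⟨(-2) ^ j * q.num - q.den * z, ?_⟩
    have hqn : (q.den : ℝ) * q = q.num := by
      exact_mod_cast Rat.den_mul_eq_num q
    push_cast
    rw [← hqn, ← hz, hδ]; ring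
  obtain ⟨i, hi, j, hj, hij, he⟩ := Finset.exists_ne_map_eq_of_card_lt_of_maps_to
    (s := Finset.range (hR.toFinset.card + 1)) (t := hR.toFinset)
    (f := fun i => u (n - 2 * i) - (-2) ^ (2 * i) * δ) (by simp) (fun i hi => by
      rw [SetLike.mem_coe, Finset.mem_range] at hi
      simpa using hg (2 * i) (by omega))
  wlog hlt : i < j generalizing i j
  · exact this j hj i hi hij.symm he.symm (by omega)
  rw [Finset.mem_range] at hi hj
  refine ⟨2 * (j - i), by omega, by omega, ?_⟩
  -- The segment starts at time `n - 2 * j`, where the error is largest; halving it forwards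
  -- recovers the later errors.
  have hpow : ∀ k ≤ 2 * j, (-1 / 2 : ℝ) ^ k * ((-2) ^ (2 * j) * δ) = (-2) ^ (2 * j - k) * δ := by
    intro k hk
    have : (-2 : ℝ) ^ (2 * j) = (-2) ^ k * (-2) ^ (2 * j - k) := by
      rw [← pow_add]; congr 1; omega
    rw [this, ← mul_assoc, ← mul_assoc, ← mul_pow]; norm_num
  refine IsHalvingOrbit.tendsto_of_segment hc hu (R := R) (ρ := ρ) (η := (-2) ^ (2 * j) * δ)
    (m := n - 2 * j) hsep ((hbig _ (by omega)).trans_le (min_le_left _ _)) (even_two_mul _)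
    (by omega) (fun k hk => ?_) ?_
  · rw [hpow k (by omega), show n - 2 * j + k = n - (2 * j - k) by omega]
    exact hg _ (by omega)
  · rw [hpow _ (by omega), show n - 2 * j + 2 * (j - i) = n - 2 * i by omega,
      show 2 * j - 2 * (j - i) = 2 * i by omega, he]

/-- Tameness holds for all large `N`, so one `N` serves every jump. Orbits that are not close to a
jump after time `N` avoid all of them by `1 / (N + 1)`. -/
lemma exists_isAsymptoticallyPeriodic {D : Finset ℝ} {c : ℝ → ℤ} (hc : IsBranch D c)
    (hD : ∀ d ∈ D, IsTameAt c d) :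
    ∃ N, ∀ u, IsHalvingOrbit c u → IsAsymptoticallyPeriodic N u := by
  obtain ⟨N, hN⟩ := ((eventually_all_finset D).mpr hD).exists
  refine ⟨N + 1, fun u hu => ?_⟩
  by_cases h : ∃ d ∈ D, ∃ n ≥ N, |u n - d| < 1 / ((N : ℝ) + 1)
  · obtain ⟨d, hd, n, hn, hlt⟩ := h
    exact (hN d hd u hu n hn hlt).mono (Nat.le_succ N)
  · push Not at h
    exact hu.isAsymptoticallyPeriodic_of_avoids hc (ε := 1 / ((N : ℝ) + 1)) (M := N)
      (by positivity) (by simp) fun n hn d hd => h d hd n hn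

/-! ### Finiteness of the limit set -/

/-- The periodic points of `x ↦ -2 x` modulo `1` of period at most `N`, lifted to `[-2, 2]`. -/
def boundedPeriodicPoints (N : ℕ) : Set ℝ :=
  {y | ∃ p, 0 < p ∧ p ≤ N ∧ ∃ z : ℤ, ((-2) ^ p - 1) * y = z ∧ |y| ≤ 2}

lemma one_le_abs_neg_two_pow_sub_one {p : ℕ} (hp : 0 < p) : (1 : ℝ) ≤ |(-2) ^ p - 1| := by
  have h1 : (2 : ℝ) ^ 1 ≤ 2 ^ p := pow_le_pow_right₀ (by norm_num) hp
  have h2 : |(-2 : ℝ) ^ p| = 2 ^ p := by rw [abs_pow]; norm_num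
  have h3 := abs_sub_abs_le_abs_sub ((-2 : ℝ) ^ p) 1
  rw [h2, abs_one] at h3
  linarith

lemma finite_boundedPeriodicPoints (N : ℕ) : (boundedPeriodicPoints N).Finite := by
  have : boundedPeriodicPoints N ⊆ ⋃ p ∈ Set.Icc 1 N,
      (fun z : ℤ => (z : ℝ) / ((-2) ^ p - 1)) '' Icc (-(2 ^ p + 1) * 2) ((2 ^ p + 1) * 2) := by
    rintro y ⟨p, hp, hpN, z, hz, hy⟩
    have h1 := one_le_abs_neg_two_pow_sub_one hp
    have h0 : ((-2 : ℝ) ^ p - 1) ≠ 0 := by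
      intro h; rw [h] at h1; norm_num at h1
    simp only [mem_iUnion]
    refine ⟨p, ⟨hp, hpN⟩, z, ?_, ?_⟩
    · have h2 : |(-2 : ℝ) ^ p - 1| ≤ 2 ^ p + 1 := by
        refine (abs_sub _ _).trans ?_
        rw [abs_pow]; norm_num
      have h3 : |(z : ℝ)| ≤ (2 ^ p + 1) * 2 := by
        rw [← hz, abs_mul]
        exact mul_le_mul h2 hy (abs_nonneg _) (by positivity)
      rw [abs_le] at h3
      constructor
      · have := h3.1
        rw [← neg_mul] at this
        exact_mod_cast this
      · exact_mod_cast h3.2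
    · simp only [← hz]; field_simp
  exact ((Set.finite_Icc 1 N).biUnion fun p _ => (Set.finite_Icc _ _).image _).subset this

/-- By `backward_int`, `((-2) ^ p - 1) * u k` differs from an integer by `(-2) ^ p * (u (k + p) - u
k)`, which tends to 0. -/
lemma IsHalvingOrbit.tendsto_nhdsSet {c : ℝ → ℤ} {u : ℕ → ℝ} (hu : IsHalvingOrbit c u) {N : ℕ}
    (h : IsAsymptoticallyPeriodic N u) :
    Tendsto u atTop (𝓝ˢ (boundedPeriodicPoints N)) := by
  obtain ⟨p, hp, hpN, ht⟩ := h
  rw [(Metric.hasBasis_nhdsSet_thickening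
    (finite_boundedPeriodicPoints N).isCompact).tendsto_right_iff]
  intro ε hε
  have ht2 : Tendsto (fun k => 2 ^ p * |u (k + p) - u k|) atTop (𝓝 0) := by
    simpa using ht.abs.const_mul (2 ^ p)
  filter_upwards [ht2.eventually_lt_const (lt_min hε one_pos)] with k hk
  obtain ⟨z, hz⟩ := hu.backward_int k p
  have h1 := one_le_abs_neg_two_pow_sub_one hp
  have h0 : ((-2 : ℝ) ^ p - 1) ≠ 0 := by
    intro h; rw [h] at h1; norm_num at h1
  have hd : |u k - z / ((-2) ^ p - 1)| < min ε 1 := by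
    refine lt_of_le_of_lt ?_ hk
    have e : u k - z / ((-2) ^ p - 1) =
        (-((-2) ^ p * (u (k + p) - u k))) / ((-2) ^ p - 1) := by
      field_simp; linear_combination hz
    rw [e, abs_div, abs_neg, abs_mul, abs_pow, show |(-2 : ℝ)| = 2 by simp]
    exact div_le_self (by positivity) h1
  rw [Metric.mem_thickening_iff]
  refine ⟨z / ((-2) ^ p - 1), ⟨p, hp, hpN, z, by field_simp, ?_⟩,
    hd.trans_le (min_le_left _ _)⟩
  have h3 := abs_lt.mp (hd.trans_le (min_le_right _ _))
  have h4 := (hu k).1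
  rw [abs_le]
  constructor <;> linarith [h4.1, h4.2]

/-! ### From trajectories to the Poincaré map -/

namespace SwitchedServerSystem

/-- The state in which a server that starts at tank `j` in state `p` empties this tank. -/
noncomputable def drain (j : Fin 3) (p : Fin 3 → ℝ) : Fin 3 → ℝ :=
  fun k => p k + 3 / 2 * p j * (1 / 3 - if j = k then 1 else 0)

variable {S : SwitchedServerSystem}

lemma next_pos {p : Fin 3 → ℝ} (hp : p ∈ stdSimplex ℝ (Fin 3)) {i : Fin 3} (hi : p i = 0) :
    0 < p (S.next i p) := by
  obtain ⟨k, hk⟩ : ∃ k, 0 < p k := by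
    by_contra! h
    have h1 := hp.2
    have h2 : ∑ k, p k ≤ 0 := Finset.sum_nonpos fun k _ => h k
    linarith
  have hki : k ≠ i := fun h => by rw [h, hi] at hk; exact hk.false
  have h1 := S.next_max i p hp hi k hki
  have h2 := S.d_pos i k hki.symm
  have h3 := S.d_pos i _ (S.next_ne i p hp hi).symm
  exact pos_of_mul_pos_right (lt_of_lt_of_le (mul_pos h2 hk) h1) h3.le

/-- At a vertex all fluid is in one tank, and the server must go there whichever empty tank it
leaves. This makes the map single-valued. -/
lemma next_eq_next {p : Fin 3 → ℝ} (hp : p ∈ stdSimplex ℝ (Fin 3)) {i i' : Fin 3}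
    (hi : p i = 0) (hi' : p i' = 0) : S.next i p = S.next i' p := by
  by_cases h : i = i'
  · rw [h]
  have h1 : ∀ k, 0 < p k → k ≠ i ∧ k ≠ i' := fun k hk =>
    ⟨fun e => by rw [e, hi] at hk; exact hk.false, fun e => by rw [e, hi'] at hk; exact hk.false⟩
  have h2 := h1 _ (next_pos (S := S) hp hi)
  have h3 := h1 _ (next_pos (S := S) hp hi')
  generalize S.next i p = a at *
  generalize S.next i' p = b at *
  omega

lemma drain_mem {p : Fin 3 → ℝ} (hp : p ∈ stdSimplex ℝ (Fin 3)) (j : Fin 3) :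
    drain j p ∈ simplexBoundary := by
  refine ⟨⟨fun k => ?_, ?_⟩, j, ?_⟩
  · have := hp.1 k
    have := hp.1 j
    unfold drain
    split_ifs with h
    · subst h; linarith
    · linarith
  · have h := hp.2
    simp only [drain, Finset.sum_add_distrib, ← Finset.mul_sum, Finset.sum_sub_distrib, h]
    simp
  · simp only [drain, if_true]; ring

/-- The motion while the server is at tank `j`. -/
noncomputable def flow (j : Fin 3) (p : Fin 3 → ℝ) (t : ℝ) : Fin 3 → ℝ :=
  fun k => p k + t * (1 / 3 - if j = k then 1 else 0)

/-- The served tank loses fluid at net rate `2/3`, so it empties at time `3 / 2 * p j`. -/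
lemma flow_end (j : Fin 3) (p : Fin 3 → ℝ) : flow j p (3 / 2 * p j) = drain j p := rfl

lemma flow_hasDerivWithinAt (j : Fin 3) (p : Fin 3 → ℝ) (s : Set ℝ) (t : ℝ) :
    HasDerivWithinAt (flow j p) (fun k => 1 / 3 - if j = k then 1 else 0) s t := by
  rw [hasDerivWithinAt_pi]
  intro k
  simpa [flow] using ((hasDerivWithinAt_id t s).mul_const _).const_add (p k)

lemma flow_continuous (j : Fin 3) (p : Fin 3 → ℝ) : Continuous (flow j p) := by
  unfold flow; fun_prop

lemma flow_mem_stdSimplex {j : Fin 3} {p : Fin 3 → ℝ} (hp : p ∈ stdSimplex ℝ (Fin 3)) {t : ℝ}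
    (ht : t ∈ Icc 0 (3 / 2 * p j)) : flow j p t ∈ stdSimplex ℝ (Fin 3) := by
  refine ⟨fun k => ?_, ?_⟩
  · have := hp.1 k
    have := ht.1
    have := ht.2
    unfold flow
    split_ifs with h
    · subst h; linarith
    · linarith
  · have h := hp.2
    simp only [flow, Finset.sum_add_distrib, ← Finset.mul_sum, Finset.sum_sub_distrib, h]
    simp

lemma flow_pos {j : Fin 3} {p : Fin 3 → ℝ} (hp : p ∈ stdSimplex ℝ (Fin 3)) {t : ℝ}
    (ht : t ∈ Ioo 0 (3 / 2 * p j)) (k : Fin 3) : 0 < flow j p t k := by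
  have := hp.1 k
  have := ht.1
  have := ht.2
  unfold flow
  split_ifs with h
  · subst h; linarith
  · linarith

lemma eventually_eq_of_lt {T t : ℝ} (ht : t < T) (a b : Fin 3) :
    ∀ᶠ s in 𝓝 t, (if s < T then a else b) = a := by
  filter_upwards [Iio_mem_nhds ht] with s hs
  exact if_pos hs

lemma firstReturn_drain {p : Fin 3 → ℝ} (hp : p ∈ stdSimplex ℝ (Fin 3)) {i : Fin 3}
    (hi : p i = 0) : S.FirstReturn p (drain (S.next i p) p) := by
  have hpos := next_pos (S := S) hp hi
  set j := S.next i p with hj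
  have hT : 0 < 3 / 2 * p j := by linarith
  refine ⟨3 / 2 * p j, flow j p, fun t => if t < 3 / 2 * p j then j else S.next j (drain j p), hT,
    ⟨fun t ht => flow_mem_stdSimplex hp ht, (flow_continuous j p).continuousOn, ?_, ?_, ?_⟩,
    ?_, ⟨i, hi, ?_⟩, ?_, ?_, rfl⟩
  · intro t ht
    refine ContinuousAt.continuousWithinAt (continuousAt_const.congr (f := fun _ => j) ?_)
    filter_upwards [eventually_eq_of_lt ht.2 j (S.next j (drain j p))] with s hs using hs.symm
  · intro t ht
    rw [if_pos ht.2]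
    exact flow_hasDerivWithinAt j p _ t
  · intro t ht
    refine ⟨j, ?_, ?_, ?_⟩
    · filter_upwards [self_mem_nhdsWithin] with s hs
      exact if_pos (lt_of_lt_of_le hs ht.2)
    · intro h
      refine if_pos ?_
      simp only [flow, if_true] at h
      linarith
    · intro h
      have : t = 3 / 2 * p j := by
        simp only [flow, if_true] at h
        linarith
      rw [this, if_neg (lt_irrefl _), flow_end]
  · ext k; simp [flow]
  · exact if_pos hT
  · rintro t ht ⟨-, k, hk⟩
    exact (flow_pos hp ht k).ne' hk
  · rw [flow_end]; exact drain_mem hp j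

/-- Before the first return the server does not move. -/
lemma IsTrajectory.server_const {T : ℝ} {v : ℝ → Fin 3 → ℝ} {l : ℝ → Fin 3}
    (h : S.IsTrajectory T v l) (hint : ∀ t ∈ Ioo 0 T, v t ∉ simplexBoundary) :
    ∀ t ∈ Ico 0 T, l t = l 0 := by
  -- In the interior no tank is empty, so the switching rule forbids a jump of `l` from the left.
  have hcont : ContinuousOn l (Ico 0 T) := by
    intro t ht
    rcases ht.1.eq_or_lt with h0 | h0
    · subst h0
      exact (h.right_continuous 0 ht).mono Ico_subset_Ici_self
    · obtain ⟨i, hi, hi', -⟩ := h.switching t ⟨h0, ht.2.le⟩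
      have hmem := h.mem_simplex t ⟨h0.le, ht.2.le⟩
      have hpos : 0 < v t i := lt_of_le_of_ne (hmem.1 i) fun e =>
        hint t ⟨h0, ht.2⟩ ⟨hmem, i, e.symm⟩
      have hl := hi' hpos
      refine ContinuousAt.continuousWithinAt ?_
      rw [ContinuousAt, ← nhdsLT_sup_nhdsGE]
      refine Tendsto.sup ?_ (h.right_continuous t ht)
      refine (tendsto_const_nhds (x := l t)).congr' ?_
      filter_upwards [hi] with s hs
      rw [hl, hs]
  intro t ht
  exact isPreconnected_Ico.constant hcont ht ⟨le_rfl, ht.1.trans_lt ht.2⟩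

lemma IsTrajectory.eq_flow {T : ℝ} {v : ℝ → Fin 3 → ℝ} {l : ℝ → Fin 3}
    (h : S.IsTrajectory T v l) {j : Fin 3} (hj : ∀ t ∈ Ico 0 T, l t = j) :
    ∀ t ∈ Icc 0 T, v t = flow j (v 0) t := by
  intro t ht
  have := constant_of_has_deriv_right_zero (f := fun t => v t - flow j (v 0) t) (a := 0) (b := T)
    (h.continuousOn.sub (flow_continuous j _).continuousOn) (fun s hs => by
      have h1 := h.hasDeriv s hs
      rw [hj s hs] at h1
      have h2 := h1.sub (flow_hasDerivWithinAt j (v 0) _ s)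
      rwa [sub_self] at h2) t ht
  have h0 : flow j (v 0) 0 = v 0 := by ext k; simp [flow]
  simp only [h0, sub_self] at this
  exact sub_eq_zero.mp this

lemma FirstReturn.eq_drain {p q : Fin 3 → ℝ} (hp : p ∈ stdSimplex ℝ (Fin 3))
    (h : S.FirstReturn p q) : ∃ i, p i = 0 ∧ q = drain (S.next i p) p := by
  obtain ⟨T, v, l, hT, htr, rfl, ⟨i, hi, hl⟩, hint, hb, rfl⟩ := h
  refine ⟨i, hi, ?_⟩
  have hflow := htr.eq_flow (j := S.next i (v 0)) fun t ht => by
    rw [htr.server_const hint t ht, hl]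
  have hTv := hflow T ⟨hT.le, le_rfl⟩
  rw [hTv]
  obtain ⟨hs, k, hk⟩ := hb
  -- Only the served tank can be empty at `T`, since the others have been filling.
  suffices T = 3 / 2 * v 0 (S.next i (v 0)) by
    conv_lhs => rw [this]
    exact flow_end _ _
  rw [hTv] at hs hk
  have h1 := hs.1 (S.next i (v 0))
  simp only [flow, if_true] at h1
  rcases eq_or_ne (S.next i (v 0)) k with rfl | hne
  · simp only [flow, if_true] at hk
    linarith
  · have := hp.1 k
    simp only [flow, if_neg hne] at hk
    linarith

/-- The Poincaré map. -/
noncomputable def poincareMap (S : SwitchedServerSystem) (p : simplexBoundary) : simplexBoundary :=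
  ⟨drain (S.next p.2.2.choose p) p, drain_mem p.2.1 _⟩

lemma poincareMap_apply (p : simplexBoundary) {i : Fin 3} (hi : p.1 i = 0) :
    (S.poincareMap p : Fin 3 → ℝ) = drain (S.next i p) p := by
  rw [← next_eq_next p.2.1 p.2.2.choose_spec hi]; rfl

lemma isPoincareMap_poincareMap (S : SwitchedServerSystem) : S.IsPoincareMap S.poincareMap := by
  intro p q
  constructor
  · rintro rfl
    exact firstReturn_drain p.2.1 p.2.2.choose_spec
  · intro h
    obtain ⟨i, hi, hq⟩ := h.eq_drain p.2.1
    exact Subtype.ext ((poincareMap_apply p hi).trans hq.symm)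

end SwitchedServerSystem

/-! ### Discontinuities with rich base-4 expansions -/

lemma four_mul_ofDigits (w : ℕ → Fin 4) :
    4 * Real.ofDigits w = (w 0 : ℕ) + Real.ofDigits fun i => w (i + 1) := by
  rw [Real.ofDigits_eq_sum_add_ofDigits w 1]
  simp [Real.ofDigitsTerm]
  ring

lemma four_pow_mul_ofDigits (w : ℕ → Fin 4) (m : ℕ) :
    ∃ z : ℤ, 4 ^ m * Real.ofDigits w = z + Real.ofDigits fun i => w (i + m) := by
  induction m with
  | zero => exact ⟨0, by simp⟩
  | succ m ih =>
    obtain ⟨z, hz⟩ := ih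
    have h := four_mul_ofDigits fun i => w (i + m)
    refine ⟨4 * z + (w (0 + m) : ℕ), ?_⟩
    rw [show (fun i => w (i + (m + 1))) = fun i => w (i + 1 + m) by
      funext i; congr 1; ring]
    push_cast
    rw [pow_succ]
    linear_combination 4 * hz + h

lemma ofDigits_mem_Icc {w : ℕ → Fin 4} {a : ℕ}
    (ha : 16 * (w 0 : ℕ) + 4 * (w 1 : ℕ) + (w 2 : ℕ) = a) :
    Real.ofDigits w ∈ Icc (a / 64 : ℝ) ((a + 1) / 64) := by
  have h0 := four_mul_ofDigits w
  have h1 := four_mul_ofDigits fun i => w (i + 1)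
  have h2 := four_mul_ofDigits fun i => w (i + 1 + 1)
  have h3 := Real.ofDigits_nonneg fun i => w (i + 1 + 1 + 1)
  have h4 := Real.ofDigits_le_one fun i => w (i + 1 + 1 + 1)
  have h5 : (16 * (w 0 : ℕ) + 4 * (w 1 : ℕ) + (w 2 : ℕ) : ℝ) = a := by exact_mod_cast ha
  simp only [zero_add, Nat.reduceAdd] at h1 h2
  constructor <;> linarith

/-- A number whose expansion contains all words of length `3` is never approached when the map
omits an interval of length `1 / 8`. -/
lemma isTameAt_of_containsAllWords {c : ℝ → ℤ} {d A B : ℝ} (hd : ContainsAllWordsBaseFour 3 d)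
    (hA : 0 ≤ A) (hB : B ≤ 1) (hAB : 1 / 8 ≤ B - A)
    (hgap : ∀ u, IsHalvingOrbit c u → ∀ n, u (n + 1) ∉ Ioo A B) : IsTameAt c d := by
  obtain ⟨w, rfl, hw⟩ := hd
  -- With the offset 2, `[a / 64, (a + 1) / 64]` stays more than `1/64` away from both ends of `(A,
  -- B)`, which leaves room for the error.
  set a := ⌊64 * A⌋₊ + 2 with ha
  have hle := Nat.floor_le (show 0 ≤ 64 * A by linarith)
  have hlt := Nat.lt_floor_add_one (64 * A)
  have hcast : (a : ℝ) = (⌊64 * A⌋₊ : ℝ) + 2 := by rw [ha]; push_cast; ring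
  have ha64 : a < 64 := by
    have : (a : ℝ) < 64 := by linarith
    exact_mod_cast this
  -- The word consists of the three base-4 digits of `a < 64`.
  obtain ⟨m, hm⟩ := hw ![⟨a / 16, by omega⟩, ⟨a / 4 % 4, by omega⟩, ⟨a % 4, by omega⟩]
  have hy : Real.ofDigits (fun i => w (i + m)) ∈ Icc (a / 64 : ℝ) ((a + 1) / 64) := by
    refine ofDigits_mem_Icc ?_
    have h0 := hm 0
    have h1 := hm 1
    have h2 := hm 2
    simp at h0 h1 h2
    simp only [add_comm _ m, add_zero, h0, h1, h2]
    omega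
  obtain ⟨z, hz⟩ := four_pow_mul_ofDigits w m
  have hlim : ∀ᶠ N : ℕ in atTop, 4 ^ m * (1 / ((N : ℝ) + 1)) < 1 / 64 := by
    have := (tendsto_one_div_add_atTop_nhds_zero_nat (𝕜 := ℝ)).const_mul (4 ^ m)
    rw [mul_zero] at this
    exact this.eventually_lt_const (by positivity)
  -- The extra 1 gives the point at time `n - 2 * m` a predecessor, so that it lies in the image.
  filter_upwards [hlim, eventually_ge_atTop (2 * m + 1)] with N hN hmN u hu n hn hclose
  exfalso
  obtain ⟨z', hz'⟩ := hu.backward_int (n - 2 * m) (2 * m)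
  rw [Nat.sub_add_cancel (by omega), pow_mul, show ((-2 : ℝ) ^ 2) = 4 by norm_num] at hz'
  have hsmall : |4 ^ m * (u n - Real.ofDigits w)| < 1 / 64 := by
    refine lt_of_le_of_lt ?_ hN
    rw [abs_mul, abs_of_pos (show (0 : ℝ) < 4 ^ m by positivity)]
    gcongr
  rw [abs_lt] at hsmall
  have hI := (hu (n - 2 * m)).1
  have e : u (n - 2 * m) = (z - z' : ℤ) +
      (Real.ofDigits (fun i => w (i + m)) + 4 ^ m * (u n - Real.ofDigits w)) := by
    push_cast; linear_combination -hz' + hz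
  have hzero : z - z' = 0 := by
    have h1 : ((z - z' : ℤ) : ℝ) < 1 := by linarith [hI.2, hy.1, hsmall.1]
    have h2 : (-1 : ℝ) < ((z - z' : ℤ) : ℝ) := by linarith [hI.1, hy.2, hsmall.2]
    have h3 : z - z' < 1 := by exact_mod_cast h1
    have h4 : -1 < z - z' := by exact_mod_cast h2
    omega
  rw [hzero, Int.cast_zero, zero_add] at e
  refine hgap u hu (n - 2 * m - 1) ?_
  rw [Nat.sub_add_cancel (by omega), e]
  constructor
  · linarith [hy.1, hsmall.1]
  · linarith [hy.2, hsmall.2]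

/-! ### Three discontinuities and the gap in the image -/

/-- The branches of the Poincaré map in the circle coordinate. -/
structure IsThreeBranch (x₁ x₂ x₃ : ℝ) (c : ℝ → ℤ) : Prop where
  one_or_two : ∀ x, c x = 1 ∨ c x = 2
  first : ∀ x ∈ Ioo 0 x₁, c x = 1
  second : ∀ x ∈ Ioo x₁ x₂, c x = 2
  third : ∀ x ∈ Ioo x₂ x₃, c x = 1
  fourth : ∀ x ∈ Ioo x₃ 1, c x = 2

namespace IsThreeBranch

variable {x₁ x₂ x₃ : ℝ} {c : ℝ → ℤ}

lemma isBranch (h : IsThreeBranch x₁ x₂ x₃ c) : IsBranch {x₁, x₂, x₃} c := by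
  intro x hx y hy hxy hd
  have hx0 := hx.1
  have hy1 := hy.2
  rcases hd x₁ (by simp) with h1 | h1
  · rcases hd x₂ (by simp) with h2 | h2
    · rcases hd x₃ (by simp) with h3 | h3
      · rw [h.fourth x ⟨h3, by linarith⟩, h.fourth y ⟨by linarith, hy1⟩]
      · rw [h.third x ⟨h2, by linarith⟩, h.third y ⟨by linarith, h3⟩]
    · rw [h.second x ⟨h1, by linarith⟩, h.second y ⟨by linarith, h2⟩]
  · rw [h.first x ⟨hx0, by linarith⟩, h.first y ⟨by linarith, h1⟩]

/-- The image of the map omits four intervals of total length `1 / 2`. -/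
lemma exists_gap (h : IsThreeBranch x₁ x₂ x₃ c) (h01 : 0 < x₁) (h12 : x₁ < x₂) (h23 : x₂ < x₃)
    (h31 : x₃ < 1) :
    ∃ A B : ℝ, 0 ≤ A ∧ B ≤ 1 ∧ 1 / 8 ≤ B - A ∧
      ∀ u, IsHalvingOrbit c u → ∀ n, u (n + 1) ∉ Ioo A B := by
  -- Closed intervals cover either choice of branch at a jump.
  have key : ∀ u, IsHalvingOrbit c u → ∀ n,
      (u n ∈ Icc 0 x₁ ∧ u (n + 1) = (1 - u n) / 2) ∨
      (u n ∈ Icc x₁ x₂ ∧ u (n + 1) = (2 - u n) / 2) ∨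
      (u n ∈ Icc x₂ x₃ ∧ u (n + 1) = (1 - u n) / 2) ∨
      (u n ∈ Icc x₃ 1 ∧ u (n + 1) = (2 - u n) / 2) := by
    intro u hu n
    obtain ⟨⟨h0, h1⟩, h2⟩ := hu n
    have hc := h.one_or_two (u n)
    rcases lt_trichotomy (u n) x₁ with g1 | g1 | g1
    · rw [h.first _ ⟨h0, g1⟩] at h2
      exact .inl ⟨⟨h0.le, g1.le⟩, by simpa using h2⟩
    · rcases hc with hc | hc <;> rw [hc] at h2
      · exact .inl ⟨⟨h0.le, g1.le⟩, by simpa using h2⟩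
      · exact .inr (.inl ⟨⟨g1.ge, by linarith⟩, by simpa using h2⟩)
    rcases lt_trichotomy (u n) x₂ with g2 | g2 | g2
    · rw [h.second _ ⟨g1, g2⟩] at h2
      exact .inr (.inl ⟨⟨g1.le, g2.le⟩, by simpa using h2⟩)
    · rcases hc with hc | hc <;> rw [hc] at h2
      · exact .inr (.inr (.inl ⟨⟨g2.ge, by linarith⟩, by simpa using h2⟩))
      · exact .inr (.inl ⟨⟨g1.le, g2.le⟩, by simpa using h2⟩)
    rcases lt_trichotomy (u n) x₃ with g3 | g3 | g3
    · rw [h.third _ ⟨g2, g3⟩] at h2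
      exact .inr (.inr (.inl ⟨⟨g2.le, g3.le⟩, by simpa using h2⟩))
    · rcases hc with hc | hc <;> rw [hc] at h2
      · exact .inr (.inr (.inl ⟨⟨g2.le, g3.le⟩, by simpa using h2⟩))
      · exact .inr (.inr (.inr ⟨⟨g3.ge, h1.le⟩, by simpa using h2⟩))
    · rw [h.fourth _ ⟨g3, h1⟩] at h2
      exact .inr (.inr (.inr ⟨⟨g3.le, h1.le⟩, by simpa using h2⟩))
  have omits : ∀ A B : ℝ, (∀ x y : ℝ, (x ∈ Icc 0 x₁ ∧ y = (1 - x) / 2) ∨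
      (x ∈ Icc x₁ x₂ ∧ y = (2 - x) / 2) ∨ (x ∈ Icc x₂ x₃ ∧ y = (1 - x) / 2) ∨
      (x ∈ Icc x₃ 1 ∧ y = (2 - x) / 2) → y ≤ A ∨ B ≤ y) →
      ∀ u, IsHalvingOrbit c u → ∀ n, u (n + 1) ∉ Ioo A B := by
    rintro A B hAB u hu n ⟨g1, g2⟩
    rcases hAB _ _ (key u hu n) with g | g <;> linarith
  by_cases g1 : 1 / 8 ≤ (1 - x₃) / 2
  · refine ⟨0, (1 - x₃) / 2, le_rfl, by linarith, by linarith, omits _ _ ?_⟩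
    rintro x y (⟨⟨e1, e2⟩, e3⟩ | ⟨⟨e1, e2⟩, e3⟩ | ⟨⟨e1, e2⟩, e3⟩ | ⟨⟨e1, e2⟩, e3⟩) <;>
      right <;> linarith
  by_cases g2 : 1 / 8 ≤ (x₂ - x₁) / 2
  · refine ⟨(1 - x₂) / 2, (1 - x₁) / 2, by linarith, by linarith, by linarith, omits _ _ ?_⟩
    rintro x y (⟨⟨e1, e2⟩, e3⟩ | ⟨⟨e1, e2⟩, e3⟩ | ⟨⟨e1, e2⟩, e3⟩ | ⟨⟨e1, e2⟩, e3⟩) <;>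
      first | (left; linarith) | (right; linarith)
  by_cases g3 : 1 / 8 ≤ (x₃ - x₂) / 2
  · refine ⟨(2 - x₃) / 2, (2 - x₂) / 2, by linarith, by linarith, by linarith, omits _ _ ?_⟩
    rintro x y (⟨⟨e1, e2⟩, e3⟩ | ⟨⟨e1, e2⟩, e3⟩ | ⟨⟨e1, e2⟩, e3⟩ | ⟨⟨e1, e2⟩, e3⟩) <;>
      first | (left; linarith) | (right; linarith)
  -- The four lengths add up to `1/2`; the other three are below `1/8`, so this one exceeds it.
  · refine ⟨(2 - x₁) / 2, 1, by linarith, le_rfl, by linarith, omits _ _ ?_⟩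
    rintro x y (⟨⟨e1, e2⟩, e3⟩ | ⟨⟨e1, e2⟩, e3⟩ | ⟨⟨e1, e2⟩, e3⟩ | ⟨⟨e1, e2⟩, e3⟩) <;>
      left <;> linarith

theorem exists_finite_attractor (h : IsThreeBranch x₁ x₂ x₃ c) (h01 : 0 < x₁) (h12 : x₁ < x₂)
    (h23 : x₂ < x₃) (h31 : x₃ < 1)
    (hx₁ : (∃ q : ℚ, x₁ = q) ∨ ContainsAllWordsBaseFour 3 x₁)
    (hx₂ : (∃ q : ℚ, x₂ = q) ∨ ContainsAllWordsBaseFour 3 x₂)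
    (hx₃ : (∃ q : ℚ, x₃ = q) ∨ ContainsAllWordsBaseFour 3 x₃) :
    ∃ Φ : Set ℝ, Φ.Finite ∧ ∀ u, IsHalvingOrbit c u → Tendsto u atTop (𝓝ˢ Φ) := by
  have hb := h.isBranch
  obtain ⟨A, B, hA, hB, hAB, hgap⟩ := h.exists_gap h01 h12 h23 h31
  have htame : ∀ d : ℝ, ((∃ q : ℚ, d = q) ∨ ContainsAllWordsBaseFour 3 d) → IsTameAt c d := by
    rintro d (⟨q, rfl⟩ | hd)
    · exact isTameAt_ratCast hb q
    · exact isTameAt_of_containsAllWords hd hA hB hAB hgap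
  obtain ⟨N, hN⟩ := exists_isAsymptoticallyPeriodic hb (by
    intro d hd
    simp only [Finset.mem_insert, Finset.mem_singleton] at hd
    rcases hd with rfl | rfl | rfl
    exacts [htame _ hx₁, htame _ hx₂, htame _ hx₃])
  exact ⟨_, finite_boundedPeriodicPoints N, fun u hu => hu.tendsto_nhdsSet (hN u hu)⟩

end IsThreeBranch

/-! ### The circle coordinate on the boundary -/

/-- The boundary of the simplex, parametrized by `[0, 1]`. -/
noncomputable def boundaryPoint (x : ℝ) : Fin 3 → ℝ :=
  ![max 0 (min (3 * x - 1) (3 - 3 * x)), max 0 (max (1 - 3 * x) (3 * x - 2)),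
    max 0 (min (3 * x) (2 - 3 * x))]

lemma continuous_boundaryPoint : Continuous boundaryPoint := by
  refine continuous_pi fun i => ?_
  fin_cases i <;> simp only [boundaryPoint] <;> simp <;> fun_prop

lemma boundaryPoint_zero_edge {x : ℝ} (h0 : 0 ≤ x) (h1 : x ≤ 1 / 3) :
    boundaryPoint x = ![0, 1 - 3 * x, 3 * x] := by
  rw [boundaryPoint, min_eq_left (by linarith), max_eq_left (by linarith),
    max_eq_left (by linarith : 3 * x - 2 ≤ 1 - 3 * x), max_eq_right (by linarith),
    min_eq_left (by linarith), max_eq_right (by linarith)]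

lemma boundaryPoint_one_edge {x : ℝ} (h0 : 1 / 3 ≤ x) (h1 : x ≤ 2 / 3) :
    boundaryPoint x = ![3 * x - 1, 0, 2 - 3 * x] := by
  rw [boundaryPoint, min_eq_left (by linarith), max_eq_right (by linarith),
    max_eq_left (max_le (by linarith) (by linarith)),
    min_eq_right (by linarith), max_eq_right (by linarith)]

lemma boundaryPoint_two_edge {x : ℝ} (h0 : 2 / 3 ≤ x) (h1 : x ≤ 1) :
    boundaryPoint x = ![3 - 3 * x, 3 * x - 2, 0] := by
  rw [boundaryPoint, min_eq_right (by linarith), max_eq_right (by linarith),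
    max_eq_right (by linarith : 1 - 3 * x ≤ 3 * x - 2), max_eq_right (by linarith),
    min_eq_right (by linarith), max_eq_left (by linarith)]

lemma exists_boundaryPoint_eq {v : Fin 3 → ℝ} (hv : v ∈ simplexBoundary) :
    ∃ x ∈ Icc (0 : ℝ) 1, boundaryPoint x = v := by
  obtain ⟨⟨h, hsum⟩, i, hi⟩ := hv
  rw [Fin.sum_univ_three] at hsum
  have h0 := h 0
  have h1 := h 1
  have h2 := h 2
  fin_cases i
  · simp at hi
    refine ⟨v 2 / 3, ⟨by linarith, by linarith⟩, ?_⟩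
    rw [boundaryPoint_zero_edge (by linarith) (by linarith)]
    ext k; fin_cases k <;> simp <;> linarith
  · simp at hi
    refine ⟨(v 0 + 1) / 3, ⟨by linarith, by linarith⟩, ?_⟩
    rw [boundaryPoint_one_edge (by linarith) (by linarith)]
    ext k; fin_cases k <;> simp <;> linarith
  · simp at hi
    refine ⟨(v 1 + 2) / 3, ⟨by linarith, by linarith⟩, ?_⟩
    rw [boundaryPoint_two_edge (by linarith) (by linarith)]
    ext k; fin_cases k <;> simp <;> linarith

lemma boundaryPoint_mem {x : ℝ} (hx : x ∈ Icc (0 : ℝ) 1) : boundaryPoint x ∈ simplexBoundary := by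
  obtain ⟨h0, h1⟩ := hx
  rcases le_total x (1 / 3) with h | h
  · rw [boundaryPoint_zero_edge h0 h]
    refine ⟨⟨fun k => ?_, by simp [Fin.sum_univ_three]⟩, 0, rfl⟩
    fin_cases k <;> simp <;> linarith
  rcases le_total x (2 / 3) with h' | h'
  · rw [boundaryPoint_one_edge h h']
    refine ⟨⟨fun k => ?_, by simp [Fin.sum_univ_three]; ring⟩, 1, rfl⟩
    fin_cases k <;> simp <;> linarith
  · rw [boundaryPoint_two_edge h' h1]
    refine ⟨⟨fun k => ?_, by simp [Fin.sum_univ_three]; ring⟩, 2, rfl⟩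
    fin_cases k <;> simp <;> linarith

/-! ### The Poincaré map in the circle coordinate -/

namespace SwitchedServerSystem

variable {S : SwitchedServerSystem}

open Classical in
/-- The branch of the Poincaré map in the coordinate given by `boundaryPoint`. -/
noncomputable def branch (S : SwitchedServerSystem) (x : ℝ) : ℤ :=
  if x ≤ 1 / 3 then if S.next 0 (boundaryPoint x) = 1 then 1 else 2
  else if x ≤ 2 / 3 then if S.next 1 (boundaryPoint x) = 0 then 1 else 2
  else if S.next 2 (boundaryPoint x) = 0 then 1 else 2

lemma branch_eq_one_or_two (x : ℝ) : S.branch x = 1 ∨ S.branch x = 2 := by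
  unfold branch; split_ifs <;> simp

/-- One step of the Poincaré map in coordinates, at each of the three edges. -/
lemma branch_cases {x : ℝ} (hx : x ∈ Icc (0 : ℝ) 1) :
    ∃ i, boundaryPoint x i = 0 ∧
      drain (S.next i (boundaryPoint x)) (boundaryPoint x) =
        boundaryPoint ((S.branch x - x) / 2) ∧
      ((S.branch x : ℝ) - x) / 2 ∈ Ioo (0 : ℝ) 1 := by
  have hmem := (boundaryPoint_mem hx).1
  obtain ⟨h0, h1⟩ := hx
  by_cases h : x ≤ 1 / 3
  · have e := boundaryPoint_zero_edge h0 h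
    have hz : boundaryPoint x 0 = 0 := by rw [e]; rfl
    have hne := S.next_ne 0 _ hmem hz
    have hpos := next_pos (S := S) hmem hz
    refine ⟨0, hz, ?_⟩
    by_cases hn : S.next 0 (boundaryPoint x) = 1
    · have hb : S.branch x = 1 := by simp only [branch, if_pos h, if_pos hn]
      rw [hb, hn, e, boundaryPoint_one_edge (by push_cast; linarith) (by push_cast; linarith)]
      refine ⟨?_, by push_cast; constructor <;> linarith⟩
      ext k; fin_cases k <;> simp [drain] <;> ring
    · have hb : S.branch x = 2 := by simp only [branch, if_pos h, if_neg hn]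
      have hn2 : S.next 0 (boundaryPoint x) = 2 := by omega
      -- Positivity of the chosen tank excludes `x = 0`, whose image would be the endpoint 1.
      rw [hn2, e] at hpos
      simp at hpos
      rw [hb, hn2, e, boundaryPoint_two_edge (by push_cast; linarith) (by push_cast; linarith)]
      refine ⟨?_, by push_cast; constructor <;> linarith⟩
      ext k; fin_cases k <;> simp [drain] <;> ring
  by_cases h' : x ≤ 2 / 3
  · have e := boundaryPoint_one_edge (not_le.mp h).le h'
    have hz : boundaryPoint x 1 = 0 := by rw [e]; rfl
    have hne := S.next_ne 1 _ hmem hz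
    refine ⟨1, hz, ?_⟩
    by_cases hn : S.next 1 (boundaryPoint x) = 0
    · have hb : S.branch x = 1 := by simp only [branch, if_neg h, if_pos h', if_pos hn]
      rw [hb, hn, e, boundaryPoint_zero_edge (by push_cast; linarith) (by push_cast; linarith)]
      refine ⟨?_, by push_cast; constructor <;> linarith⟩
      ext k; fin_cases k <;> simp [drain] <;> ring
    · have hb : S.branch x = 2 := by simp only [branch, if_neg h, if_pos h', if_neg hn]
      have hn2 : S.next 1 (boundaryPoint x) = 2 := by omega
      rw [hb, hn2, e, boundaryPoint_two_edge (by push_cast; linarith) (by push_cast; linarith)]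
      refine ⟨?_, by push_cast; constructor <;> linarith⟩
      ext k; fin_cases k <;> simp [drain] <;> ring
  · have e := boundaryPoint_two_edge (not_le.mp h').le h1
    have hz : boundaryPoint x 2 = 0 := by rw [e]; rfl
    have hne := S.next_ne 2 _ hmem hz
    have hpos := next_pos (S := S) hmem hz
    refine ⟨2, hz, ?_⟩
    by_cases hn : S.next 2 (boundaryPoint x) = 0
    · have hb : S.branch x = 1 := by simp only [branch, if_neg h, if_neg h', if_pos hn]
      rw [hn, e] at hpos
      simp at hpos
      rw [hb, hn, e, boundaryPoint_zero_edge (by push_cast; linarith) (by push_cast; linarith)]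
      refine ⟨?_, by push_cast; constructor <;> linarith⟩
      ext k; fin_cases k <;> simp [drain] <;> ring
    · have hb : S.branch x = 2 := by simp only [branch, if_neg h, if_neg h', if_neg hn]
      have hn2 : S.next 2 (boundaryPoint x) = 1 := by omega
      rw [hb, hn2, e, boundaryPoint_one_edge (by push_cast; linarith) (by push_cast; linarith)]
      refine ⟨?_, by push_cast; constructor <;> linarith⟩
      ext k; fin_cases k <;> simp [drain] <;> ring

/-- If tank `k` has a strictly larger scaled volume than tank `j`, the server does not move from
tank `i` to tank `j`. -/
lemma next_ne_of_lt {v : Fin 3 → ℝ} (hv : v ∈ stdSimplex ℝ (Fin 3)) {i j k : Fin 3} (hi : v i = 0)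
    (hk : k ≠ i) (h : S.d i j * v j < S.d i k * v k) : S.next i v ≠ j := by
  intro e
  have := S.next_max i v hv hi k hk
  rw [e] at this
  linarith

/-- The formulas for `d₁`, `d₂`, `d₃` say that the two scaled volumes on each edge tie exactly at
`x₁`, `x₂`, `x₃`. The branches agree across the vertices `1/3` and `2/3`, so no further jumps occur.
-/
lemma isThreeBranch {x₁ x₂ x₃ d₁ d₂ d₃ : ℝ}
    (hx₁ : x₁ ∈ Ioo (0 : ℝ) (1 / 3)) (hx₂ : x₂ ∈ Ioo (1 / 3 : ℝ) (2 / 3))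
    (hx₃ : x₃ ∈ Ioo (2 / 3 : ℝ) 1)
    (hd₁ : d₁ = 1 / (3 * x₁) - 1)
    (hd₂ : d₂ = (2 - 3 * x₂) / (3 * x₂ - 1))
    (hd₃ : d₃ = (3 - 3 * x₃) / (3 * x₃ - 2))
    (hS₁ : S.d 0 2 / S.d 0 1 = d₁) (hS₂ : S.d 1 0 / S.d 1 2 = d₂)
    (hS₃ : S.d 2 1 / S.d 2 0 = d₃) : IsThreeBranch x₁ x₂ x₃ S.branch := by
  have p01 := S.d_pos 0 1 (by decide)
  have p12 := S.d_pos 1 2 (by decide)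
  have p20 := S.d_pos 2 0 (by decide)
  obtain ⟨hx₁, hx₁'⟩ := hx₁
  obtain ⟨hx₂, hx₂'⟩ := hx₂
  obtain ⟨hx₃, hx₃'⟩ := hx₃
  have e₁ : S.d 0 2 * (3 * x₁) = S.d 0 1 * (1 - 3 * x₁) := by
    rw [hd₁] at hS₁; field_simp at hS₁; linarith
  have e₂ : S.d 1 0 * (3 * x₂ - 1) = S.d 1 2 * (2 - 3 * x₂) := by
    have : 3 * x₂ - 1 ≠ 0 := by linarith
    rw [hd₂] at hS₂; field_simp at hS₂; linarith
  have e₃ : S.d 2 1 * (3 * x₃ - 2) = S.d 2 0 * (3 - 3 * x₃) := by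
    have : 3 * x₃ - 2 ≠ 0 := by linarith
    rw [hd₃] at hS₃; field_simp at hS₃; linarith
  have p02 := S.d_pos 0 2 (by decide)
  have p10 := S.d_pos 1 0 (by decide)
  have p21 := S.d_pos 2 1 (by decide)
  have edge0 : ∀ x ∈ Icc (0 : ℝ) (1 / 3), (x < x₁ → S.branch x = 1) ∧
      (x₁ < x → S.branch x = 2) := by
    rintro x ⟨h0, h1⟩
    have hmem := (boundaryPoint_mem (x := x) ⟨h0, by linarith⟩).1
    have e := boundaryPoint_zero_edge h0 h1
    have hz : boundaryPoint x 0 = 0 := by rw [e]; rfl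
    have hne := S.next_ne 0 _ hmem hz
    refine ⟨fun h => ?_, fun h => ?_⟩
    · have hn := next_ne_of_lt (S := S) hmem hz (j := 2) (k := 1) (by decide) (by
        rw [e]; simp; nlinarith)
      have hn2 : S.next 0 (boundaryPoint x) = 1 := by omega
      simp only [branch, if_pos h1, if_pos hn2]
    · have hn := next_ne_of_lt (S := S) hmem hz (j := 1) (k := 2) (by decide) (by
        rw [e]; simp; nlinarith)
      simp only [branch, if_pos h1, if_neg hn]
  have edge1 : ∀ x ∈ Ioc (1 / 3 : ℝ) (2 / 3), (x < x₂ → S.branch x = 2) ∧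
      (x₂ < x → S.branch x = 1) := by
    rintro x ⟨h0, h1⟩
    have hmem := (boundaryPoint_mem (x := x) ⟨by linarith, by linarith⟩).1
    have e := boundaryPoint_one_edge h0.le h1
    have hz : boundaryPoint x 1 = 0 := by rw [e]; rfl
    have hne := S.next_ne 1 _ hmem hz
    refine ⟨fun h => ?_, fun h => ?_⟩
    · have hn := next_ne_of_lt (S := S) hmem hz (j := 0) (k := 2) (by decide) (by
        rw [e]; simp; nlinarith)
      simp only [branch, if_neg h0.not_ge, if_pos h1, if_neg hn]
    · have hn := next_ne_of_lt (S := S) hmem hz (j := 2) (k := 0) (by decide) (by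
        rw [e]; simp; nlinarith)
      have hn2 : S.next 1 (boundaryPoint x) = 0 := by omega
      simp only [branch, if_neg h0.not_ge, if_pos h1, if_pos hn2]
  have edge2 : ∀ x ∈ Ioc (2 / 3 : ℝ) 1, (x < x₃ → S.branch x = 1) ∧
      (x₃ < x → S.branch x = 2) := by
    rintro x ⟨h0, h1⟩
    have hmem := (boundaryPoint_mem (x := x) ⟨by linarith, by linarith⟩).1
    have e := boundaryPoint_two_edge h0.le h1
    have hz : boundaryPoint x 2 = 0 := by rw [e]; rfl
    have hne := S.next_ne 2 _ hmem hz
    have h3 : ¬ x ≤ 1 / 3 := by linarith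
    refine ⟨fun h => ?_, fun h => ?_⟩
    · have hn := next_ne_of_lt (S := S) hmem hz (j := 1) (k := 0) (by decide) (by
        rw [e]; simp; nlinarith)
      have hn2 : S.next 2 (boundaryPoint x) = 0 := by omega
      simp only [branch, if_neg h3, if_neg h0.not_ge, if_pos hn2]
    · have hn := next_ne_of_lt (S := S) hmem hz (j := 0) (k := 1) (by decide) (by
        rw [e]; simp; nlinarith)
      simp only [branch, if_neg h3, if_neg h0.not_ge, if_neg hn]
  refine ⟨branch_eq_one_or_two, fun x hx => ?_, fun x hx => ?_, fun x hx => ?_, fun x hx => ?_⟩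
  · exact (edge0 x ⟨hx.1.le, by linarith [hx.2]⟩).1 hx.2
  · rcases le_or_gt x (1 / 3) with h | h
    · exact (edge0 x ⟨by linarith [hx.1], h⟩).2 hx.1
    · exact (edge1 x ⟨h, by linarith [hx.2]⟩).1 hx.2
  · rcases le_or_gt x (2 / 3) with h | h
    · exact (edge1 x ⟨by linarith [hx.1], h⟩).2 hx.1
    · exact (edge2 x ⟨h, by linarith [hx.2]⟩).1 hx.2
  · exact (edge2 x ⟨by linarith [hx.1], hx.2.le⟩).2 hx.1

lemma poincareMap_boundaryPoint {x : ℝ} (hx : x ∈ Icc (0 : ℝ) 1) {p : simplexBoundary}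
    (hp : (p : Fin 3 → ℝ) = boundaryPoint x) :
    (S.poincareMap p : Fin 3 → ℝ) = boundaryPoint ((S.branch x - x) / 2) := by
  obtain ⟨i, hi, he, -⟩ := branch_cases (S := S) hx
  rw [poincareMap_apply p (i := i) (by rw [hp, hi]), hp, he]

/-- The orbit is taken from the first iterate on, because the initial coordinate may be 0 or 1 while
every image lies in the open interval. -/
lemma exists_orbit (p : simplexBoundary) : ∃ u : ℕ → ℝ, IsHalvingOrbit S.branch u ∧
    ∀ n, (S.poincareMap^[n + 1] p : Fin 3 → ℝ) = boundaryPoint (u n) := by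
  obtain ⟨x, hx, hxp⟩ := exists_boundaryPoint_eq p.2
  set f : ℝ → ℝ := fun y => (S.branch y - y) / 2 with hf
  have hmaps : ∀ y ∈ Icc (0 : ℝ) 1, f y ∈ Ioo (0 : ℝ) 1 := fun y hy => by
    obtain ⟨-, -, -, h⟩ := branch_cases (S := S) hy
    exact h
  have hI : ∀ n, f^[n + 1] x ∈ Ioo (0 : ℝ) 1 := by
    intro n
    induction n with
    | zero => exact hmaps x hx
    | succ n ih =>
      rw [Function.iterate_succ_apply']
      exact hmaps _ (Ioo_subset_Icc_self ih)
  refine ⟨fun n => f^[n + 1] x, fun n => ⟨hI n, ?_⟩, fun n => ?_⟩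
  · simp only [Function.iterate_succ_apply' f (n + 1)]
    rfl
  · induction n with
    | zero => exact poincareMap_boundaryPoint hx hxp.symm
    | succ n ih =>
      rw [Function.iterate_succ_apply']
      simp only [Function.iterate_succ_apply' f (n + 1)]
      exact poincareMap_boundaryPoint (Ioo_subset_Icc_self (hI n)) ih

/-- Orbits converge to the image of `Φ`, which is finite and hence closed, so no point outside it
can be a cluster point. -/
lemma finite_globalAttractor {Φ : Set ℝ} (hΦ : Φ.Finite)
    (h : ∀ u, IsHalvingOrbit S.branch u → Tendsto u atTop (𝓝ˢ Φ)) :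
    (globalAttractor S.poincareMap).Finite := by
  have hfin := hΦ.image boundaryPoint
  refine (hfin.preimage (f := ((↑) : simplexBoundary → Fin 3 → ℝ))
    Subtype.val_injective.injOn).subset ?_
  intro y hy
  simp only [globalAttractor, mem_iUnion] at hy
  obtain ⟨p, hy⟩ := hy
  rw [mem_omegaLimit_singleton_iff_mapClusterPt] at hy
  obtain ⟨u, hu, hup⟩ := exists_orbit (S := S) p
  have ht : Tendsto (fun n => (S.poincareMap^[n] p : Fin 3 → ℝ)) atTop
      (𝓝ˢ (boundaryPoint '' Φ)) := by
    rw [← tendsto_add_atTop_iff_nat 1]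
    simp only [hup]
    exact (continuous_boundaryPoint.tendsto_nhdsSet (mapsTo_image _ _)).comp (h u hu)
  by_contra hcon
  have hcl : MapClusterPt (y : Fin 3 → ℝ) atTop
      (fun n => (S.poincareMap^[n] p : Fin 3 → ℝ)) :=
    hy.continuousAt_comp continuous_subtype_val.continuousAt
  have hdis : Disjoint (𝓝 (y : Fin 3 → ℝ)) (𝓝ˢ (boundaryPoint '' Φ)) := by
    rw [disjoint_nhds_nhdsSet, hfin.isClosed.closure_eq]
    exact hcon
  have hne : (𝓝 (y : Fin 3 → ℝ) ⊓ map (fun n => (S.poincareMap^[n] p : Fin 3 → ℝ)) atTop).NeBot :=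
    hcl
  exact hne.ne (hdis.mono_right ht).eq_bot

end SwitchedServerSystem

theorem corollary1 (x₁ x₂ x₃ d₁ d₂ d₃ : ℝ)
    (hx₁ : x₁ ∈ Set.Ioo (0 : ℝ) (1 / 3))
    (hx₂ : x₂ ∈ Set.Ioo (1 / 3 : ℝ) (2 / 3))
    (hx₃ : x₃ ∈ Set.Ioo (2 / 3 : ℝ) 1)
    (h₁ : (∃ q : ℚ, x₁ = q) ∨ (Irrational x₁ ∧ ContainsAllWordsBaseFour 3 x₁))
    (h₂ : (∃ q : ℚ, x₂ = q) ∨ (Irrational x₂ ∧ ContainsAllWordsBaseFour 3 x₂))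
    (h₃ : (∃ q : ℚ, x₃ = q) ∨ (Irrational x₃ ∧ ContainsAllWordsBaseFour 3 x₃))
    (hd₁ : d₁ = 1 / (3 * x₁) - 1)
    (hd₂ : d₂ = (2 - 3 * x₂) / (3 * x₂ - 1))
    (hd₃ : d₃ = (3 - 3 * x₃) / (3 * x₃ - 2))
    (S : SwitchedServerSystem)
    (hS₁ : S.d 0 2 / S.d 0 1 = d₁)
    (hS₂ : S.d 1 0 / S.d 1 2 = d₂)
    (hS₃ : S.d 2 1 / S.d 2 0 = d₃) :
    ∃ F : simplexBoundary → simplexBoundary,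
      S.IsPoincareMap F ∧ (globalAttractor F).Finite := by
  have hb := SwitchedServerSystem.isThreeBranch hx₁ hx₂ hx₃ hd₁ hd₂ hd₃ hS₁ hS₂ hS₃
  obtain ⟨Φ, hΦ, h⟩ := hb.exists_finite_attractor hx₁.1 (hx₁.2.trans hx₂.1) (hx₂.2.trans hx₃.1)
    hx₃.2 (h₁.imp_right And.right) (h₂.imp_right And.right) (h₃.imp_right And.right)
  exact ⟨S.poincareMap, S.isPoincareMap_poincareMap,
    SwitchedServerSystem.finite_globalAttractor hΦ h⟩
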